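/- Let $L\ge 1$ and let $X\sim\mathcal N(0,\Sigma_X)$ be a Gaussian vector in $\mathbb R^L$ with $\Sigma_X\succ 0$ and eigenvalue decomposition $\Sigma_X=\Theta^T\,\mathrm{diag}(\lambda_1,\dots,\lambda_L)\,\Theta$, $\Theta$ orthogonal. Let the perception loss $\phi(P_X,P_{\hat X})$ be either the KL-divergence $D(P_{\hat X}\|P_X)$ or the squared Wasserstein-2 distance $W_2^2(P_X,P_{\hat X})$, and let $$R(D,P)=\inf\{I(X;\hat X)\;:\;P_{\hat X|X},\ \mathbb E\|X-\hat X\|^2\le D,\ \phi(P_X,P_{\hat X})\le P\}$$ be the information rate-distortion-perception function (natural logarithms). The water levels $\gamma^*_\ell(D,P)$ are the $\gamma$-part of the optimal solution $(\gamma^*,\hat\lambda^*)$ of the problem of minimizing $\frac12\sum_{\ell=1}^L\log\frac{\lambda_\ell}{\gamma_\ell}$ subject to $0<\gamma_\ell\le\lambda_\ell$, $\hat\lambda_\ell\ge 0$, $\sum_{\ell}\bigl(\lambda_\ell-2\sqrt{\hat\lambda_\ell(\lambda_\ell-\gamma_\ell)}+\hat\lambda_\ell\bigr)\le D$ and $\sum_\ell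 P_\ell(\hat\lambda_\ell)\le P$, where $P_\ell(\hat\lambda_\ell)=\frac12\bigl(\frac{\hat\lambda_\ell}{\lambda_\ell}-1+\log\frac{\lambda_\ell}{\hat\lambda_\ell}\bigr)$ for the KL-divergence (with $P_\ell(0)=\infty$) and $P_\ell(\hat\lambda_\ell)=\bigl(\sqrt{\lambda_\ell}-\sqrt{\hat\lambda_\ell}\bigr)^2$ for the Wasserstein-2 distance. Then, for all sufficiently small $\epsilon>0$, with constants in $O(\cdot)$ not depending on $\epsilon$: the rate is finite and $$R\Bigl(2\sum_{\ell=1}^L\lambda_\ell-\epsilon,\,0\Bigr)=\frac{\epsilon^2}{8\sum_{\ell=1}^L\lambda_\ell^2}+O(\epsilon^3);$$ the optimization problem with $D=2\sum_\ell\lambda_\ell-\epsilon$ and $P=0$ has exactly one optimal solution, its optimal value is $R(2\sum_\ell\lambda_\ell-\epsilon,0)$, and its water levels satisfy $$\gamma^*_\ell\Bigl(2\sum_{k=1}^L\lambda_k-\epsilon,\,0\Bigr)=\lambda_\ell-\frac{\epsilon^2\lambda_\ell^3}{4\bigl(\sum_{k=1}^L\lambda_k^2\bigr)^2}+O(\epsilon^3),\qquad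 \ell\in\{1,\dots,L\}.$$ -/

import Mathlib

open MeasureTheory ProbabilityTheory
open scoped ENNReal

namespace RDP

noncomputable section

/-- The mutual information `I(X; Y)` in nats, where `X ∼ μ` and `κ` is the conditional law of `Y`
given `X`: the divergence of the joint law from the product of the marginal laws. -/
def mutualInfo {E : Type*} [MeasurableSpace E] (μ : Measure E) (κ : Kernel E E) : ℝ≥0∞ :=
  InformationTheory.klDiv (μ.compProd κ) (μ.prod (μ.bind κ))

/-- The expected squared error `𝔼[‖X - Y‖ ^ 2]`, where `X ∼ μ` and `κ` is the conditional law of `Y`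
given `X`. -/
def distortion {E : Type*} [NormedAddCommGroup E] [MeasurableSpace E]
    (μ : Measure E) (κ : Kernel E E) : ℝ≥0∞ :=
  ∫⁻ p, ‖p.1 - p.2‖ₑ ^ 2 ∂(μ.compProd κ)

/-- The squared Wasserstein-2 distance: the infimum of `𝔼[‖U - V‖ ^ 2]` over all joint laws of
`(U, V)` with marginals `μ` and `ν`. -/
def wassersteinSq {E : Type*} [NormedAddCommGroup E] [MeasurableSpace E]
    (μ ν : Measure E) : ℝ≥0∞ :=
  ⨅ (π : Measure (E × E)) (_ : π.fst = μ) (_ : π.snd = ν), ∫⁻ p, ‖p.1 - p.2‖ₑ ^ 2 ∂π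

/-- The two perception metrics: KL-divergence and squared Wasserstein-2 distance. -/
inductive PerceptionMetric where
  | kl
  | w2

/-- The perception loss `φ(P_X, P_Y)` between the source law `μ = P_X` and the reconstruction law
`ν = P_Y`; for `kl` it is `D(P_Y ‖ P_X)`. -/
def PerceptionMetric.loss {E : Type*} [NormedAddCommGroup E] [MeasurableSpace E] :
    PerceptionMetric → Measure E → Measure E → ℝ≥0∞
  | .kl, μ, ν => InformationTheory.klDiv ν μ
  | .w2, μ, ν => wassersteinSq μ ν

/-- The information rate-distortion-perception function `R(D, P)` of a source with law `μ`: the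
infimum of the mutual information over all conditional laws of the reconstruction given the source
that have distortion at most `D` and perception loss at most `P` (`∞` if there are none). -/
def rate {E : Type*} [NormedAddCommGroup E] [MeasurableSpace E]
    (φ : PerceptionMetric) (μ : Measure E) (D P : ℝ≥0∞) : ℝ≥0∞ :=
  ⨅ (κ : Kernel E E) (_ : IsMarkovKernel κ) (_ : distortion μ κ ≤ D)
    (_ : φ.loss μ (μ.bind κ) ≤ P), mutualInfo μ κ

/-- The distortion of one component of variance `lam` that is compressed to the level `γ` and then
reconstructed with variance `lamHat`. -/
def componentDistortion (lam γ lamHat : ℝ) : ℝ :=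
  lam - 2 * √(lamHat * (lam - γ)) + lamHat

/-- The perception loss of one component of variance `lam > 0` that is reconstructed with variance
`lamHat ≥ 0`. For the KL-divergence it is infinite at `lamHat = 0`. -/
def PerceptionMetric.componentLoss : PerceptionMetric → ℝ → ℝ → ℝ≥0∞
  | .kl, lam, lamHat =>
      if 0 < lamHat then ENNReal.ofReal (1 / 2 * (lamHat / lam - 1 + Real.log (lam / lamHat)))
      else ∞
  | .w2, lam, lamHat => ENNReal.ofReal ((√lam - √lamHat) ^ 2)

/-- The total rate of an allocation with water levels `γ`, for component variances `lam`. -/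
def allocationRate {L : ℕ} (lam γ : Fin L → ℝ) : ℝ :=
  1 / 2 * ∑ l, Real.log (lam l / γ l)

/-- The allocations `(γ, lamHat)` of water levels and reconstruction variances that satisfy the
distortion constraint `D` and the perception constraint `P`. -/
def feasibleAllocations {L : ℕ} (φ : PerceptionMetric) (lam : Fin L → ℝ) (D P : ℝ≥0∞) :
    Set ((Fin L → ℝ) × (Fin L → ℝ)) :=
  {p | (∀ l, 0 < p.1 l ∧ p.1 l ≤ lam l) ∧ (∀ l, 0 ≤ p.2 l) ∧
    ENNReal.ofReal (∑ l, componentDistortion (lam l) (p.1 l) (p.2 l)) ≤ D ∧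
    ∑ l, φ.componentLoss (lam l) (p.2 l) ≤ P}

/-- `(γ, lamHat)` is an optimal solution of the rate allocation problem: it minimizes the total rate
among the feasible allocations. Its first entry consists of the water levels `γ*_l(D, P)`. -/
def IsOptimalAllocation {L : ℕ} (φ : PerceptionMetric) (lam : Fin L → ℝ) (D P : ℝ≥0∞)
    (p : (Fin L → ℝ) × (Fin L → ℝ)) : Prop :=
  p ∈ feasibleAllocations φ lam D P ∧
    ∀ q ∈ feasibleAllocations φ lam D P, allocationRate lam p.1 ≤ allocationRate lam q.1

end

end RDP

namespace RDP

/-! At P = 0 either loss forces the reconstruction to have the source law, so the rate is the least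
mutual information of a self-coupling of the Gaussian law with mean squared error at most D = 2 ∑
λ_l - ε. In principal coordinates the candidate is the coupling with componentwise correlations ρ_l
solving ρ_l = t λ_l (1 - ρ_l²), where the multiplier t ≥ 0 is fixed by ∑ λ_l ρ_l = ε/2.

This equation makes the log-likelihood ratio f of the candidate a sum of functions of x and of y
alone minus (t/2)‖x - y‖² (`totalLogRatio_eq`). Hence its mean under any self-coupling depends only
on the distortion, and the Gibbs bound (`ofReal_integral_le_klDiv`) gives I ≥ -½ ∑ log(1 - ρ_l²).
The channel with density exp f attains this value (`exists_kernel`).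

With λ̂ = λ and r_l = √(1 - γ_l/λ_l), the allocation problem minimizes -½ ∑ log(1 - r_l²) under ∑
λ_l r_l ≥ ε/2. The same ρ and t satisfy its optimality conditions, and a strict tangent bound
(`neg_half_log_one_sub_sq_ge`) gives uniqueness. Both expansions follow from t ≈ ε/(2 ∑ λ_k²) and
ρ_l ≈ t λ_l (`exists_correlations`). -/

/-! ### Correlations and their expansions -/

/-- The nonnegative solution `r` of `r = s * (1 - r ^ 2)`. -/
noncomputable def optCorr (s : ℝ) : ℝ := 2 * s / (1 + √(1 + 4 * s ^ 2))

lemma continuous_optCorr : Continuous optCorr := by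
  unfold optCorr
  refine Continuous.div (by fun_prop) (by fun_prop) fun s => ?_
  positivity

/-- The root (√(1 + 4s²) - 1)/(2s) of s r² + r - s = 0, rationalized so that s = 0 is not
exceptional. -/
lemma optCorr_eq (s : ℝ) : optCorr s = s * (1 - optCorr s ^ 2) := by
  have h : √(1 + 4 * s ^ 2) ^ 2 = 1 + 4 * s ^ 2 := Real.sq_sqrt (by positivity)
  have hq : 0 < 1 + √(1 + 4 * s ^ 2) := by positivity
  unfold optCorr
  set q := √(1 + 4 * s ^ 2)
  field_simp
  linear_combination (-s) * h

lemma optCorr_nonneg {s : ℝ} (hs : 0 ≤ s) : 0 ≤ optCorr s := by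
  unfold optCorr; positivity

lemma optCorr_lt_one (s : ℝ) : optCorr s < 1 := by
  have h : |2 * s| < 1 + √(1 + 4 * s ^ 2) := by
    have : |2 * s| ≤ √(1 + 4 * s ^ 2) := Real.abs_le_sqrt (by nlinarith)
    linarith
  unfold optCorr
  rw [div_lt_one (by positivity)]
  exact (le_abs_self _).trans_lt h

lemma optCorr_le {s : ℝ} (hs : 0 ≤ s) : optCorr s ≤ s := by
  nlinarith [optCorr_eq s, mul_nonneg hs (sq_nonneg (optCorr s))]

lemma sub_cube_le_optCorr {s : ℝ} (hs : 0 ≤ s) : s - s ^ 3 ≤ optCorr s := by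
  have h : optCorr s ^ 2 ≤ s ^ 2 := pow_le_pow_left₀ (optCorr_nonneg hs) (optCorr_le hs) 2
  nlinarith [optCorr_eq s, mul_le_mul_of_nonneg_left h hs]

lemma abs_neg_half_log_sub_le {r : ℝ} (hr : r ^ 2 ≤ 1 / 2) :
    |-(1 / 2) * Real.log (1 - r ^ 2) - r ^ 2 / 2| ≤ r ^ 4 := by
  have h1 : 0 < 1 - r ^ 2 := by linarith
  have h2 := Real.log_le_sub_one_of_pos h1
  have h3 := Real.one_sub_inv_le_log_of_pos h1
  have h4 : (1 - r ^ 2)⁻¹ ≤ 1 + r ^ 2 + 2 * r ^ 4 := by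
    rw [inv_le_iff_one_le_mul₀ h1]
    nlinarith [mul_nonneg (pow_nonneg (sq_nonneg r) 2) (by linarith : 0 ≤ 1 - 2 * r ^ 2)]
  rw [abs_le]
  constructor <;> nlinarith [pow_nonneg (sq_nonneg r) 2]

/-- Apply log y ≤ y - 1 to y = (1 - r²)/(1 - ρ²). The slope ρ/(1 - ρ²) is the derivative at ρ; the
quadratic gain is what later yields uniqueness. -/
lemma neg_half_log_one_sub_sq_ge {r ρ : ℝ} (hr0 : 0 ≤ r) (hr : r < 1) (hρ0 : 0 ≤ ρ) (hρ : ρ < 1) :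
    -(1 / 2) * Real.log (1 - ρ ^ 2) + ρ / (1 - ρ ^ 2) * (r - ρ) + (r - ρ) ^ 2 / 2
      ≤ -(1 / 2) * Real.log (1 - r ^ 2) := by
  have h1 : 0 < 1 - r ^ 2 := by nlinarith
  have h2 : 0 < 1 - ρ ^ 2 := by nlinarith
  have h3 := Real.log_le_sub_one_of_pos (div_pos h1 h2)
  rw [Real.log_div h1.ne' h2.ne'] at h3
  have h4 : (1 - r ^ 2) / (1 - ρ ^ 2) - 1
      = -2 * (ρ / (1 - ρ ^ 2) * (r - ρ)) - (r - ρ) ^ 2 / (1 - ρ ^ 2) := by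
    field_simp; ring
  have h5 : (r - ρ) ^ 2 ≤ (r - ρ) ^ 2 / (1 - ρ ^ 2) :=
    le_div_self (sq_nonneg _) h2 (by nlinarith [sq_nonneg ρ])
  linarith

/-- For a small distortion reduction there is a Lagrange multiplier `t`, and the resulting
correlations, rate and water levels have the stated expansions. -/
lemma exists_correlations {L : ℕ} (hL : 0 < L) (lam : Fin L → ℝ) (hlam : ∀ l, 0 < lam l) :
    ∃ C ε₀ : ℝ, 0 < ε₀ ∧ ε₀ ≤ ∑ l, lam l ∧ ∀ ε : ℝ, 0 < ε → ε < ε₀ →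
      ∃ (t : ℝ) (ρ : Fin L → ℝ), 0 ≤ t ∧ (∀ l, 0 ≤ ρ l) ∧ (∀ l, ρ l < 1) ∧
        (∀ l, ρ l = t * lam l * (1 - ρ l ^ 2)) ∧ ∑ l, lam l * ρ l = ε / 2 ∧
        |∑ l, -(1 / 2) * Real.log (1 - ρ l ^ 2) - ε ^ 2 / (8 * ∑ l, lam l ^ 2)| ≤ C * ε ^ 3 ∧
        ∀ l, |lam l * (1 - ρ l ^ 2)
          - (lam l - ε ^ 2 * lam l ^ 3 / (4 * (∑ k, lam k ^ 2) ^ 2))| ≤ C * ε ^ 3 := by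
  have : Nonempty (Fin L) := ⟨⟨0, hL⟩⟩
  set A := ∑ l, lam l ^ 2 with hA
  set M := ∑ l, lam l with hM
  have hA0 : 0 < A := Finset.sum_pos (fun l _ => pow_pos (hlam l) 2) Finset.univ_nonempty
  have hM0 : 0 < M := Finset.sum_pos (fun l _ => hlam l) Finset.univ_nonempty
  have hlM : ∀ l, lam l ≤ M := fun l =>
    Finset.single_le_sum (fun k _ => (hlam k).le) (Finset.mem_univ l)
  set u := M / A with hu
  have hu0 : 0 < u := div_pos hM0 hA0
  set K := 2 * u ^ 4 * (1 + M ^ 2 / A) with hK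
  have hK0 : 0 < K := by positivity
  -- `L * (K + u ^ 4)` bounds the rate error, `M * K` the water-level error. The threshold ensures ε
  -- < 1, to absorb ε⁴ into ε³, then ε ≤ ∑ λ_l, and u ε ≤ 1/2.
  refine ⟨L * (K + u ^ 4) + M * K, min 1 (min M (1 / (2 * u))), by positivity,
    (min_le_right _ _).trans (min_le_left _ _), fun ε hε hε₀ => ?_⟩
  have hε1 : ε < 1 := hε₀.trans_le (min_le_left _ _)
  have hεu : u * ε ≤ 1 / 2 := by
    have h : ε < 1 / (2 * u) := hε₀.trans_le ((min_le_right _ _).trans (min_le_right _ _))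
    rw [lt_div_iff₀ (by positivity)] at h
    linarith
  -- the multiplier, by the intermediate value theorem
  have hcube : ∀ t : ℝ, 0 ≤ t → t ≤ ε / A → ∀ l, 0 ≤ t * lam l ∧ t * lam l ≤ u * ε := by
    intro t ht htA l
    refine ⟨mul_nonneg ht (hlam l).le, ?_⟩
    calc t * lam l ≤ ε / A * M := mul_le_mul htA (hlM l) (hlam l).le (by positivity)
      _ = u * ε := by rw [hu]; ring
  -- The right endpoint is twice the leading value ε/(2A) of t: there the cubic correction costs at
  -- most half of each term, so the sum is still at least ε/2.
  obtain ⟨t, ⟨ht0, htA⟩, ht⟩ : ε / 2 ∈ (fun t => ∑ l, lam l * optCorr (t * lam l)) ''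
      Set.Icc 0 (ε / A) := by
    refine intermediate_value_Icc (by positivity) ?_ ⟨?_, ?_⟩
    · exact (continuous_finsetSum _ fun l _ => continuous_const.mul
        (continuous_optCorr.comp (by fun_prop))).continuousOn
    · simp [optCorr]; positivity
    · have h : ∀ l ∈ Finset.univ, ε / A * lam l ^ 2 / 2 ≤ lam l * optCorr (ε / A * lam l) := by
        intro l _
        obtain ⟨h1, h2⟩ := hcube (ε / A) (by positivity) le_rfl l
        have h3 := sub_cube_le_optCorr h1
        have h4 : (ε / A * lam l) ^ 2 ≤ 1 / 2 := by nlinarith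
        have h5 : ε / A * lam l / 2 ≤ optCorr (ε / A * lam l) := by nlinarith
        nlinarith [mul_le_mul_of_nonneg_left h5 (hlam l).le]
      refine le_trans (le_of_eq ?_) (Finset.sum_le_sum h)
      rw [← Finset.sum_div, ← Finset.mul_sum, ← hA]
      field_simp
  have ht' : ∑ l, lam l * optCorr (t * lam l) = ε / 2 := ht
  set ρ : Fin L → ℝ := fun l => optCorr (t * lam l) with hρ
  have hρ0 : ∀ l, 0 ≤ ρ l := fun l => optCorr_nonneg (hcube t ht0 htA l).1
  have hρu : ∀ l, ρ l ≤ u * ε := fun l =>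
    (optCorr_le (hcube t ht0 htA l).1).trans (hcube t ht0 htA l).2
  have hρt : ∀ l, |t * lam l - ρ l| ≤ (u * ε) ^ 3 := by
    intro l
    obtain ⟨h1, h2⟩ := hcube t ht0 htA l
    have h3 := sub_cube_le_optCorr h1
    have h4 := pow_le_pow_left₀ h1 h2 3
    have h5 := optCorr_le h1
    rw [abs_of_nonneg (sub_nonneg.2 h5)]
    linarith
  have htε : |t - ε / (2 * A)| ≤ M / A * (u * ε) ^ 3 := by
    have h : t - ε / (2 * A) = (∑ l, lam l * (t * lam l - ρ l)) / A := by
      -- Weighting the errors t λ_l - ρ_l by λ_l isolates t, since ∑ λ_l ρ_l is known exactly.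
      have : ∑ l, lam l * (t * lam l - ρ l) = t * A - ε / 2 := by
        rw [hA, Finset.mul_sum, ← ht', ← Finset.sum_sub_distrib]
        exact Finset.sum_congr rfl fun l _ => by ring
      rw [this]; field_simp
    rw [h, abs_div, abs_of_pos hA0, div_mul_eq_mul_div, hM, Finset.sum_mul]
    refine div_le_div_of_nonneg_right ((Finset.abs_sum_le_sum_abs _ _).trans
      (Finset.sum_le_sum fun l _ => ?_)) hA0.le
    rw [abs_mul, abs_of_pos (hlam l)]
    exact mul_le_mul_of_nonneg_left (hρt l) (hlam l).le
  have hd : ∀ l, |ρ l - ε * lam l / (2 * A)| ≤ (1 + M ^ 2 / A) * (u * ε) ^ 3 := by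
    intro l
    have h1 : ρ l - ε * lam l / (2 * A) = -(t * lam l - ρ l) + lam l * (t - ε / (2 * A)) := by ring
    rw [h1]
    refine (abs_add_le _ _).trans ?_
    rw [abs_neg, abs_mul, abs_of_pos (hlam l)]
    have h2 : lam l * |t - ε / (2 * A)| ≤ M * (M / A * (u * ε) ^ 3) :=
      mul_le_mul (hlM l) htε (abs_nonneg _) hM0.le
    have h3 := hρt l
    have h4 : (1 + M ^ 2 / A) * (u * ε) ^ 3 = (u * ε) ^ 3 + M * (M / A * (u * ε) ^ 3) := by ring
    linarith
  have hsq : ∀ l, |ρ l ^ 2 - ε ^ 2 * lam l ^ 2 / (4 * A ^ 2)| ≤ K * ε ^ 3 := by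
    intro l
    have h1 : ρ l ^ 2 - ε ^ 2 * lam l ^ 2 / (4 * A ^ 2)
        = (ρ l - ε * lam l / (2 * A)) * (ρ l + ε * lam l / (2 * A)) := by
      field_simp; ring
    have h2 : ε * lam l / (2 * A) ≤ u * ε := by
      have h : ε * lam l ≤ ε * M := mul_le_mul_of_nonneg_left (hlM l) hε.le
      have h' : ε * lam l / (2 * A) ≤ ε * M / A :=
        div_le_div₀ (by positivity) h hA0 (by linarith)
      calc _ ≤ ε * M / A := h'
        _ = u * ε := by rw [hu]; ring
    have h3 : 0 ≤ ε * lam l / (2 * A) := by have := hlam l; positivity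
    have h4 : |ρ l + ε * lam l / (2 * A)| ≤ 2 * (u * ε) := by
      rw [abs_of_nonneg (add_nonneg (hρ0 l) h3)]
      linarith [hρu l]
    rw [h1, abs_mul]
    calc _ ≤ (1 + M ^ 2 / A) * (u * ε) ^ 3 * (2 * (u * ε)) :=
          mul_le_mul (hd l) h4 (abs_nonneg _) (by positivity)
      _ = K * ε ^ 3 * ε := by rw [hK]; ring
      _ ≤ K * ε ^ 3 := mul_le_of_le_one_right (by positivity) hε1.le
  have hC : ∀ x : ℝ, 0 ≤ x → 0 ≤ x * ε ^ 3 := fun x hx => by positivity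
  refine ⟨t, ρ, ht0, hρ0, fun l => optCorr_lt_one _, fun l => optCorr_eq _, ht', ?_, fun l => ?_⟩
  · have h1 : ∑ l, -(1 / 2) * Real.log (1 - ρ l ^ 2) - ε ^ 2 / (8 * A)
        = ∑ l, ((-(1 / 2) * Real.log (1 - ρ l ^ 2) - ρ l ^ 2 / 2)
          + (ρ l ^ 2 - ε ^ 2 * lam l ^ 2 / (4 * A ^ 2)) / 2) := by
      have h2 : ε ^ 2 / (8 * A) = ∑ l, ε ^ 2 * lam l ^ 2 / (4 * A ^ 2) / 2 := by
        rw [← Finset.sum_div, ← Finset.sum_div, ← Finset.mul_sum, ← hA]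
        field_simp; norm_num
      rw [h2, ← Finset.sum_sub_distrib]
      exact Finset.sum_congr rfl fun l _ => by ring
    rw [h1]
    have h3 : ∀ l ∈ Finset.univ, |(-(1 / 2) * Real.log (1 - ρ l ^ 2) - ρ l ^ 2 / 2)
          + (ρ l ^ 2 - ε ^ 2 * lam l ^ 2 / (4 * A ^ 2)) / 2| ≤ (K + u ^ 4) * ε ^ 3 := by
      intro l _
      refine (abs_add_le _ _).trans ?_
      have h4 : ρ l ^ 2 ≤ 1 / 2 := by nlinarith [hρu l, hρ0 l]
      have h5 := abs_neg_half_log_sub_le h4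
      have h6 : ρ l ^ 4 ≤ u ^ 4 * ε ^ 3 := by
        calc ρ l ^ 4 ≤ (u * ε) ^ 4 := pow_le_pow_left₀ (hρ0 l) (hρu l) 4
          _ = u ^ 4 * ε ^ 3 * ε := by ring
          _ ≤ u ^ 4 * ε ^ 3 := mul_le_of_le_one_right (by positivity) hε1.le
      rw [abs_div, abs_of_pos (zero_lt_two' ℝ)]
      have h7 := hsq l
      have h8 := hC K hK0.le
      linarith
    refine (Finset.abs_sum_le_sum_abs _ _).trans ((Finset.sum_le_sum h3).trans ?_)
    rw [Finset.sum_const, Finset.card_univ, Fintype.card_fin, nsmul_eq_mul]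
    have := hC (M * K) (by positivity)
    linarith
  · have h1 : lam l * (1 - ρ l ^ 2) - (lam l - ε ^ 2 * lam l ^ 3 / (4 * A ^ 2))
        = -(lam l * (ρ l ^ 2 - ε ^ 2 * lam l ^ 2 / (4 * A ^ 2))) := by ring
    rw [h1, abs_neg, abs_mul, abs_of_pos (hlam l)]
    have h2 : lam l * |ρ l ^ 2 - ε ^ 2 * lam l ^ 2 / (4 * A ^ 2)| ≤ M * (K * ε ^ 3) :=
      mul_le_mul (hlM l) (hsq l) (abs_nonneg _) hM0.le
    have := hC (L * (K + u ^ 4)) (by positivity)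
    linarith

/-! ### The allocation problem at zero perception loss -/

lemma PerceptionMetric.componentLoss_eq_zero_iff (φ : PerceptionMetric) {lam x : ℝ}
    (hlam : 0 < lam) (hx : 0 ≤ x) : φ.componentLoss lam x = 0 ↔ x = lam := by
  cases φ with
  | kl =>
    simp only [componentLoss]
    constructor
    · intro h
      split_ifs at h with hx'
      · rw [ENNReal.ofReal_eq_zero] at h
        by_contra hne
        have h1 : x / lam ≠ 1 := by rwa [Ne, div_eq_one_iff_eq hlam.ne']
        have h2 := Real.log_lt_sub_one_of_pos (div_pos hx' hlam) h1
        rw [← inv_div x lam, Real.log_inv] at h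
        linarith
      · simp at h
    · rintro rfl
      simp [hlam, hlam.ne']
  | w2 =>
    simp only [componentLoss, ENNReal.ofReal_eq_zero]
    constructor
    · intro h
      have h1 := pow_eq_zero_iff (two_ne_zero) |>.1 (le_antisymm h (sq_nonneg _))
      exact ((Real.sqrt_inj hlam.le hx).1 (sub_eq_zero.1 h1)).symm
    · rintro rfl; simp

/-- Zero loss pins λ̂ = λ, and r_l = √(1 - γ_l/λ_l) makes the distortion constraint linear. The
bound on ε keeps D nonnegative, so that `ENNReal.ofReal` does not truncate it. -/
lemma mem_feasibleAllocations_iff {L : ℕ} (φ : PerceptionMetric) {lam : Fin L → ℝ}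
    (hlam : ∀ l, 0 < lam l) {ε : ℝ} (hε : ε ≤ ∑ l, lam l) (p : (Fin L → ℝ) × (Fin L → ℝ)) :
    p ∈ feasibleAllocations φ lam (ENNReal.ofReal (2 * (∑ l, lam l) - ε)) 0 ↔
      (∀ l, 0 < p.1 l ∧ p.1 l ≤ lam l) ∧ p.2 = lam ∧
        ε / 2 ≤ ∑ l, lam l * √(1 - p.1 l / lam l) := by
  have hM : 0 ≤ ∑ l, lam l := Finset.sum_nonneg fun l _ => (hlam l).le
  have hs : ∑ l, componentDistortion (lam l) (p.1 l) (lam l)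
      = 2 * (∑ l, lam l) - 2 * ∑ l, lam l * √(1 - p.1 l / lam l) := by
    rw [Finset.mul_sum, Finset.mul_sum, ← Finset.sum_sub_distrib]
    refine Finset.sum_congr rfl fun l _ => ?_
    have : lam l * (lam l - p.1 l) = lam l ^ 2 * (1 - p.1 l / lam l) := by
      have := (hlam l).ne'
      field_simp
    rw [componentDistortion, this, Real.sqrt_mul (sq_nonneg _), Real.sqrt_sq (hlam l).le]
    ring
  have key : ENNReal.ofReal (∑ l, componentDistortion (lam l) (p.1 l) (lam l))
        ≤ ENNReal.ofReal (2 * (∑ l, lam l) - ε) ↔ ε / 2 ≤ ∑ l, lam l * √(1 - p.1 l / lam l) := by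
    rw [ENNReal.ofReal_le_ofReal_iff (by linarith), hs]
    constructor <;> intro h <;> linarith
  simp only [feasibleAllocations, Set.mem_ofPred_eq]
  constructor
  · rintro ⟨h1, h2, h3, h4⟩
    have h5 : p.2 = lam := by
      funext l
      refine (φ.componentLoss_eq_zero_iff (hlam l) (h2 l)).1 ?_
      exact Finset.sum_eq_zero_iff.1 (le_zero_iff.1 h4) l (Finset.mem_univ l)
    rw [h5] at h3
    exact ⟨h1, h5, key.1 h3⟩
  · rintro ⟨h1, h2, h3⟩
    rw [h2]
    exact ⟨h1, fun l => (hlam l).le, key.2 h3, (Finset.sum_eq_zero fun l _ =>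
      (φ.componentLoss_eq_zero_iff (hlam l) (hlam l).le).2 rfl).le⟩

/-- Lagrangian duality with multiplier t: every feasible rate exceeds the candidate's by at least
half the squared distance between the correlation vectors. -/
lemma isOptimalAllocation_iff {L : ℕ} (φ : PerceptionMetric) {lam : Fin L → ℝ}
    (hlam : ∀ l, 0 < lam l) {ε : ℝ} (hε : ε ≤ ∑ l, lam l) {t : ℝ} (ht : 0 ≤ t) {ρ : Fin L → ℝ}
    (hρ0 : ∀ l, 0 ≤ ρ l) (hρ1 : ∀ l, ρ l < 1) (hρ : ∀ l, ρ l = t * lam l * (1 - ρ l ^ 2))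
    (hsum : ∑ l, lam l * ρ l = ε / 2) (p : (Fin L → ℝ) × (Fin L → ℝ)) :
    IsOptimalAllocation φ lam (ENNReal.ofReal (2 * (∑ l, lam l) - ε)) 0 p ↔
      p = (fun l => lam l * (1 - ρ l ^ 2), lam) := by
  have hpos : ∀ l, 0 < 1 - ρ l ^ 2 := fun l => by nlinarith [hρ0 l, hρ1 l]
  set p₀ : (Fin L → ℝ) × (Fin L → ℝ) := (fun l => lam l * (1 - ρ l ^ 2), lam) with hp₀
  have hmem : p₀ ∈ feasibleAllocations φ lam (ENNReal.ofReal (2 * (∑ l, lam l) - ε)) 0 := by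
    rw [mem_feasibleAllocations_iff φ hlam hε]
    refine ⟨fun l => ⟨mul_pos (hlam l) (hpos l), mul_le_of_le_one_right (hlam l).le
      (by nlinarith [sq_nonneg (ρ l)])⟩, rfl, le_of_eq ?_⟩
    rw [← hsum]
    refine Finset.sum_congr rfl fun l _ => ?_
    simp only [hp₀]
    rw [mul_div_cancel_left₀ _ (hlam l).ne', sub_sub_cancel, Real.sqrt_sq (hρ0 l)]
  have hrate₀ : allocationRate lam p₀.1 = ∑ l, -(1 / 2) * Real.log (1 - ρ l ^ 2) := by
    rw [allocationRate, Finset.mul_sum]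
    refine Finset.sum_congr rfl fun l _ => ?_
    simp only [hp₀]
    rw [← inv_div _ (lam l), Real.log_inv, mul_div_cancel_left₀ _ (hlam l).ne']
    ring
  have hlow : ∀ q ∈ feasibleAllocations φ lam (ENNReal.ofReal (2 * (∑ l, lam l) - ε)) 0,
      allocationRate lam p₀.1 + ∑ l, (√(1 - q.1 l / lam l) - ρ l) ^ 2 / 2
        ≤ allocationRate lam q.1 := by
    intro q hq
    rw [mem_feasibleAllocations_iff φ hlam hε] at hq
    obtain ⟨h1, h2, h3⟩ := hq
    have h4 : ∀ l, 0 ≤ 1 - q.1 l / lam l := fun l => by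
      rw [sub_nonneg, div_le_one (hlam l)]; exact (h1 l).2
    have h5 : ∀ l ∈ Finset.univ, -(1 / 2) * Real.log (1 - ρ l ^ 2)
        + t * (lam l * √(1 - q.1 l / lam l) - lam l * ρ l) + (√(1 - q.1 l / lam l) - ρ l) ^ 2 / 2
        ≤ 1 / 2 * Real.log (lam l / q.1 l) := by
      intro l _
      have hq := div_pos (h1 l).1 (hlam l)
      have h6 := neg_half_log_one_sub_sq_ge (Real.sqrt_nonneg (1 - q.1 l / lam l))
        ((Real.sqrt_lt' one_pos).2 (by linarith)) (hρ0 l) (hρ1 l)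
      rw [Real.sq_sqrt (h4 l), sub_sub_cancel] at h6
      -- With slope t λ_l in each component, the first-order terms add up to t times the constraint
      -- slack, which is nonnegative.
      have h7 : ρ l / (1 - ρ l ^ 2) = t * lam l := by
        rw [div_eq_iff (hpos l).ne']; exact hρ l
      rw [h7] at h6
      rw [← inv_div (q.1 l), Real.log_inv]
      linarith
    have h6 := Finset.sum_le_sum h5
    rw [Finset.sum_add_distrib, Finset.sum_add_distrib, ← Finset.mul_sum, ← Finset.mul_sum,
      Finset.sum_sub_distrib, hsum] at h6
    rw [hrate₀, ← Finset.mul_sum, allocationRate,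
      Finset.mul_sum _ (fun l => Real.log (lam l / q.1 l))]
    have := mul_nonneg ht (sub_nonneg.2 h3)
    linarith
  constructor
  · rintro ⟨hp, hopt⟩
    have h1 := hlow p hp
    have h2 := hopt p₀ hmem
    have h3 : ∑ l, (√(1 - p.1 l / lam l) - ρ l) ^ 2 / 2 = 0 :=
      le_antisymm (by linarith) (Finset.sum_nonneg fun l _ => by positivity)
    rw [Finset.sum_eq_zero_iff_of_nonneg fun l _ => by positivity] at h3
    rw [mem_feasibleAllocations_iff φ hlam hε] at hp
    refine Prod.ext (funext fun l => ?_) hp.2.1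
    have h4 := h3 l (Finset.mem_univ l)
    have h5 : √(1 - p.1 l / lam l) = ρ l := by
      have : (√(1 - p.1 l / lam l) - ρ l) ^ 2 = 0 := by linarith
      exact sub_eq_zero.1 (pow_eq_zero_iff two_ne_zero |>.1 this)
    have h6 : 0 ≤ 1 - p.1 l / lam l := by
      rw [sub_nonneg, div_le_one (hlam l)]; exact (hp.1 l).2
    have h7 := Real.sq_sqrt h6
    rw [h5] at h7
    simp only [hp₀]
    rw [h7, sub_sub_cancel, mul_div_cancel₀ _ (hlam l).ne']
  · rintro rfl
    exact ⟨hmem, fun q hq => le_trans (le_add_of_nonneg_right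
      (Finset.sum_nonneg fun l _ => by positivity)) (hlow q hq)⟩

/-! ### Variational bound on the divergence and its equality case -/

section Divergence

variable {α : Type*} [MeasurableSpace α]

/-- The Gibbs variational lower bound on the divergence. -/
lemma ofReal_integral_le_klDiv (P Q : Measure α) [IsProbabilityMeasure P] [IsProbabilityMeasure Q]
    {f : α → ℝ} (hf : Integrable f P) (hexp : Integrable (fun x => Real.exp (f x)) Q)
    (h1 : (∫ x, Real.exp (f x) ∂Q) = 1) :
    ENNReal.ofReal (∫ x, f x ∂P) ≤ InformationTheory.klDiv P Q := by
  by_cases h : InformationTheory.klDiv P Q = ∞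
  · simp [h]
  obtain ⟨hac, hint⟩ := InformationTheory.klDiv_ne_top_iff.1 h
  have : IsProbabilityMeasure (Q.tilted f) := isProbabilityMeasure_tilted hexp
  -- The divergence of P from the tilted measure is nonnegative, and it equals D(P ‖ Q) - ∫ f dP
  -- because the normalizing constant is 1.
  have h2 := InformationTheory.integral_llr_add_sub_measure_univ_nonneg
    (hac.trans (absolutelyContinuous_tilted hexp)) (integrable_llr_tilted_right hac hf hint hexp)
  rw [integral_llr_tilted_right hac hf hexp hint, h1] at h2
  rw [InformationTheory.klDiv_of_ac_of_integrable hac hint]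
  refine ENNReal.ofReal_le_ofReal ?_
  simp only [Real.log_one, probReal_univ] at h2 ⊢
  linarith

lemma klDiv_withDensity_exp (Q : Measure α) [IsProbabilityMeasure Q] {f : α → ℝ}
    (hexp : Integrable (fun x => Real.exp (f x)) Q) (h1 : (∫ x, Real.exp (f x) ∂Q) = 1)
    (hf : Integrable f (Q.withDensity fun x => ENNReal.ofReal (Real.exp (f x)))) :
    InformationTheory.klDiv (Q.withDensity fun x => ENNReal.ofReal (Real.exp (f x))) Q
      = ENNReal.ofReal
        (∫ x, f x ∂(Q.withDensity fun x => ENNReal.ofReal (Real.exp (f x)))) := by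
  have htilt : Q.withDensity (fun x => ENNReal.ofReal (Real.exp (f x))) = Q.tilted f := by
    simp [Measure.tilted, h1]
  rw [htilt] at hf ⊢
  have : IsProbabilityMeasure (Q.tilted f) := isProbabilityMeasure_tilted hexp
  have hac := tilted_absolutelyContinuous Q f
  have hllr : llr (Q.tilted f) Q =ᵐ[Q.tilted f] f := by
    filter_upwards [hac.ae_le (log_rnDeriv_tilted_left_self hexp)] with x hx
    rw [llr_def]; simp [hx, h1]
  rw [InformationTheory.klDiv_of_ac_of_integrable hac ((integrable_congr hllr).2 hf),
    integral_congr_ae hllr]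
  simp

end Divergence

/-! ### Zero perception loss means equal laws -/

section Loss

variable {E : Type*} [NormedAddCommGroup E] [InnerProductSpace ℝ E] [CompleteSpace E]
  [SecondCountableTopology E] [MeasurableSpace E] [BorelSpace E]

omit [CompleteSpace E] in
-- The map s ↦ exp(is) is 1-Lipschitz; Cauchy–Schwarz and monotonicity of Lᵖ norms do the rest. As
-- this holds for every coupling, no optimal coupling has to exist for zero Wasserstein distance to
-- imply equality.
lemma enorm_charFun_sub_sq_le (π : Measure (E × E)) [IsProbabilityMeasure π] (t : E) :
    ‖charFun π.fst t - charFun π.snd t‖ₑ ^ 2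
      ≤ ‖t‖ₑ ^ 2 * ∫⁻ p, ‖p.1 - p.2‖ₑ ^ 2 ∂π := by
  have hint : ∀ g : E × E → E, Measurable g →
      Integrable (fun p => Complex.exp (inner ℝ (g p) t * Complex.I)) π := fun g hg =>
    Integrable.of_bound (C := 1) (by fun_prop)
      (ae_of_all _ fun p => (Complex.norm_exp_ofReal_mul_I _).le)
  have h1 : ‖charFun π.fst t - charFun π.snd t‖ₑ ≤ ‖t‖ₑ * ∫⁻ p, ‖p.1 - p.2‖ₑ ∂π := by
    rw [charFun_apply, charFun_apply, Measure.fst, Measure.snd,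
      integral_map (by fun_prop) (by fun_prop), integral_map (by fun_prop) (by fun_prop),
      ← integral_sub (hint _ measurable_fst) (hint _ measurable_snd),
      ← lintegral_const_mul _ (by fun_prop)]
    refine (enorm_integral_le_lintegral_enorm _).trans (lintegral_mono fun p => ?_)
    have h2 : Complex.exp (inner ℝ p.1 t * Complex.I) - Complex.exp (inner ℝ p.2 t * Complex.I)
        = Complex.exp (inner ℝ p.2 t * Complex.I)
          * (Complex.exp (Complex.I * (inner ℝ (p.1 - p.2) t : ℝ)) - 1) := by
      rw [mul_sub, ← Complex.exp_add, mul_one, inner_sub_left]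
      congr 2
      push_cast
      ring
    rw [h2, enorm_mul]
    have h3 : ‖Complex.exp (inner ℝ p.2 t * Complex.I)‖ₑ = 1 := by
      rw [← ofReal_norm, Complex.norm_exp_ofReal_mul_I, ENNReal.ofReal_one]
    rw [h3, one_mul]
    refine Real.enorm_exp_I_mul_ofReal_sub_one_le.trans ?_
    rw [← ofReal_norm, ← ofReal_norm, ← ofReal_norm, ← ENNReal.ofReal_mul (norm_nonneg _)]
    refine ENNReal.ofReal_le_ofReal ?_
    rw [mul_comm]
    exact norm_inner_le_norm _ _
  have h4 : (∫⁻ p, ‖p.1 - p.2‖ₑ ∂π) ^ 2 ≤ ∫⁻ p, ‖p.1 - p.2‖ₑ ^ 2 ∂π := by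
    have h5 := eLpNorm_le_eLpNorm_of_exponent_le (μ := π) (f := fun p : E × E => p.1 - p.2)
      (p := 1) (q := 2) (by norm_num) (by fun_prop)
    rw [eLpNorm_one_eq_lintegral_enorm] at h5
    have h6 := eLpNorm_nnreal_pow_eq_lintegral (μ := π) (f := fun p : E × E => p.1 - p.2)
      (p := 2) (by norm_num)
    have h7 := pow_le_pow_left' h5 2
    simp only [NNReal.coe_ofNat, ENNReal.rpow_ofNat, ENNReal.coe_ofNat] at h6
    rwa [h6] at h7
  calc _ ≤ (‖t‖ₑ * ∫⁻ p, ‖p.1 - p.2‖ₑ ∂π) ^ 2 := pow_le_pow_left' h1 2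
    _ ≤ _ := by rw [mul_pow]; gcongr

lemma wassersteinSq_eq_zero_iff (μ ν : Measure E) [IsProbabilityMeasure μ]
    [IsProbabilityMeasure ν] : wassersteinSq μ ν = 0 ↔ ν = μ := by
  constructor
  · intro h
    refine Measure.ext_of_charFun (funext fun t => ?_)
    by_contra hne
    have hc : 0 < ‖charFun μ t - charFun ν t‖ₑ ^ 2 :=
      ENNReal.pow_pos (by simpa [sub_eq_zero] using Ne.symm hne) 2
    -- Adding 1 keeps the divisor below nonzero even at t = 0.
    have hK : ‖t‖ₑ ^ 2 + 1 ≠ ∞ := by simp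
    have hlt : wassersteinSq μ ν < ‖charFun μ t - charFun ν t‖ₑ ^ 2 / (‖t‖ₑ ^ 2 + 1) := by
      rw [h]; exact ENNReal.div_pos hc.ne' hK
    simp only [wassersteinSq, iInf_lt_iff] at hlt
    obtain ⟨π, hπ1, hπ2, hπ⟩ := hlt
    have : IsProbabilityMeasure π := by
      constructor
      rw [← Measure.fst_univ, hπ1, measure_univ]
    have h1 := enorm_charFun_sub_sq_le π t
    rw [hπ1, hπ2] at h1
    rw [ENNReal.lt_div_iff_mul_lt (by simp) (by simp)] at hπ
    refine absurd (h1.trans ?_) (not_le.2 hπ)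
    rw [mul_comm]
    gcongr
    exact le_self_add
  · rintro rfl
    refine le_antisymm (iInf₂_le_of_le (ν.map fun x => (x, x)) ?_ (iInf_le_of_le ?_ ?_)) zero_le
    · rw [Measure.fst, Measure.map_map (by fun_prop) (by fun_prop)]; exact Measure.map_id
    · rw [Measure.snd, Measure.map_map (by fun_prop) (by fun_prop)]; exact Measure.map_id
    · rw [lintegral_map (by fun_prop) (by fun_prop)]; simp

lemma PerceptionMetric.loss_le_zero_iff (φ : PerceptionMetric) (μ ν : Measure E)
    [IsProbabilityMeasure μ] [IsProbabilityMeasure ν] : φ.loss μ ν ≤ 0 ↔ ν = μ := by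
  rw [nonpos_iff_eq_zero]
  cases φ with
  | kl => exact InformationTheory.klDiv_eq_zero_iff
  | w2 => exact wassersteinSq_eq_zero_iff μ ν

end Loss

/-! ### The bivariate Gaussian likelihood ratio -/

/-- The log-likelihood ratio of the centered bivariate Gaussian law with variances `lam` and
correlation `ρ` with respect to the product of its marginals. -/
noncomputable def gaussianLogRatio (lam ρ x y : ℝ) : ℝ :=
  -(1 / 2) * Real.log (1 - ρ ^ 2)
    - (ρ ^ 2 * (x ^ 2 + y ^ 2) - 2 * ρ * x * y) / (2 * lam * (1 - ρ ^ 2))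

@[fun_prop]
lemma Measurable.gaussianLogRatio {α : Type*} [MeasurableSpace α] {lam ρ : ℝ} {f g : α → ℝ}
    (hf : Measurable f) (hg : Measurable g) :
    Measurable fun a => gaussianLogRatio lam ρ (f a) (g a) := by
  unfold RDP.gaussianLogRatio
  fun_prop

lemma gaussianLogRatio_comm (lam ρ x y : ℝ) :
    gaussianLogRatio lam ρ x y = gaussianLogRatio lam ρ y x := by
  unfold gaussianLogRatio; ring

/-- Completing the square in y: the ratio is the density of the conditional law given x with respect
to the marginal. -/
lemma gaussianReal_withDensity_exp_gaussianLogRatio {lam ρ : ℝ} (hlam : 0 < lam)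
    (hρ : ρ ^ 2 < 1) (x : ℝ) :
    (gaussianReal 0 lam.toNNReal).withDensity
        (fun y => ENNReal.ofReal (Real.exp (gaussianLogRatio lam ρ x y)))
      = gaussianReal (ρ * x) (lam * (1 - ρ ^ 2)).toNNReal := by
  have h1 : 0 < 1 - ρ ^ 2 := by linarith
  have h2 : 0 < lam * (1 - ρ ^ 2) := mul_pos hlam h1
  rw [gaussianReal_of_var_ne_zero _ (Real.toNNReal_pos.2 hlam).ne',
    gaussianReal_of_var_ne_zero _ (Real.toNNReal_pos.2 h2).ne',
    ← withDensity_mul _ (by fun_prop) (by fun_prop)]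
  congr 1
  funext y
  rw [Pi.mul_apply, gaussianPDF, gaussianPDF, ← ENNReal.ofReal_mul (gaussianPDFReal_nonneg _ _ _)]
  congr 1
  rw [gaussianPDFReal, gaussianPDFReal, Real.coe_toNNReal _ hlam.le, Real.coe_toNNReal _ h2.le,
    gaussianLogRatio, sub_eq_add_neg _ (_ / _), Real.exp_add, ← mul_assoc (2 * Real.pi),
    Real.sqrt_mul (show 0 ≤ 2 * Real.pi * lam by positivity) (1 - ρ ^ 2), mul_inv]
  have h3 : Real.exp (-(1 / 2) * Real.log (1 - ρ ^ 2)) = (√(1 - ρ ^ 2))⁻¹ := by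
    rw [neg_mul, Real.exp_neg, Real.sqrt_eq_rpow, Real.rpow_def_of_pos h1, mul_comm (1 / 2 : ℝ)]
  rw [h3]
  have h4 : Real.exp (-(y - ρ * x) ^ 2 / (2 * (lam * (1 - ρ ^ 2))))
      = Real.exp (-(y - 0) ^ 2 / (2 * lam))
        * Real.exp (-((ρ ^ 2 * (x ^ 2 + y ^ 2) - 2 * ρ * x * y) / (2 * lam * (1 - ρ ^ 2)))) := by
    rw [← Real.exp_add]
    congr 1
    field_simp
    ring
  rw [h4]
  ring

lemma integrable_sq_gaussianReal (m : ℝ) (v : NNReal) :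
    Integrable (fun x => x ^ 2) (gaussianReal m v) := by
  simpa using (memLp_id_gaussianReal (μ := m) (v := v) 2).integrable_sq

lemma integral_sq_gaussianReal (m : ℝ) (v : NNReal) :
    (∫ x, x ^ 2 ∂(gaussianReal m v)) = v + m ^ 2 := by
  have h := variance_eq_sub (memLp_id_gaussianReal (μ := m) (v := v) 2)
  rw [variance_id_gaussianReal] at h
  simp only [Pi.pow_apply, id_eq, integral_id_gaussianReal] at h
  linarith

lemma lintegral_sub_sq_gaussianReal (a m : ℝ) (v : NNReal) :
    ∫⁻ x, ENNReal.ofReal ((a - x) ^ 2) ∂(gaussianReal m v) = ENNReal.ofReal ((a - m) ^ 2 + v) := by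
  have h := gaussianReal_map_const_sub (μ := m) (v := v) a
  have h2 : ∫⁻ x, ENNReal.ofReal ((a - x) ^ 2) ∂(gaussianReal m v)
      = ∫⁻ x, ENNReal.ofReal (x ^ 2) ∂(gaussianReal (a - m) v) := by
    rw [← h, lintegral_map (by fun_prop) (by fun_prop)]
  rw [h2, ← ofReal_integral_eq_lintegral_ofReal (integrable_sq_gaussianReal _ _)
    (ae_of_all _ fun _ => sq_nonneg _), integral_sq_gaussianReal, add_comm]

/-! ### Converse and achievability in independent Gaussian coordinates -/

/-- The functions `z l` are orthonormal coordinates on `E` that are independent centered Gaussian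
random variables of variances `lam l` under `μ`. -/
structure IsGaussianCoordinates {E ι : Type*} [Fintype ι] [NormedAddCommGroup E]
    [MeasurableSpace E] (μ : Measure E) (lam : ι → ℝ) (z : ι → E → ℝ) : Prop where
  pos : ∀ l, 0 < lam l
  measurable : ∀ l, Measurable (z l)
  indep : iIndepFun z μ
  map_eq : ∀ l, μ.map (z l) = gaussianReal 0 (lam l).toNNReal
  norm_sub_sq : ∀ x y, ‖x - y‖ ^ 2 = ∑ l, (z l x - z l y) ^ 2

/-- The sum of the component log-likelihood ratios. -/
noncomputable def totalLogRatio {E ι : Type*} [Fintype ι] (lam ρ : ι → ℝ) (z : ι → E → ℝ)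
    (x y : E) : ℝ :=
  ∑ l, gaussianLogRatio (lam l) (ρ l) (z l x) (z l y)

lemma totalLogRatio_comm {E ι : Type*} [Fintype ι] (lam ρ : ι → ℝ) (z : ι → E → ℝ) (x y : E) :
    totalLogRatio lam ρ z x y = totalLogRatio lam ρ z y x :=
  Finset.sum_congr rfl fun _ _ => gaussianLogRatio_comm _ _ _ _

namespace IsGaussianCoordinates

variable {E ι : Type*} [Fintype ι] [NormedAddCommGroup E] [MeasurableSpace E]
  {μ : Measure E} {lam : ι → ℝ} {z : ι → E → ℝ}

lemma isProbabilityMeasure (h : IsGaussianCoordinates μ lam z) : IsProbabilityMeasure μ :=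
  h.indep.isProbabilityMeasure

lemma measurable_totalLogRatio (h : IsGaussianCoordinates μ lam z) (ρ : ι → ℝ) :
    Measurable fun p : E × E => totalLogRatio lam ρ z p.1 p.2 := by
  unfold totalLogRatio
  have := h.measurable
  fun_prop

lemma enorm_sub_sq (h : IsGaussianCoordinates μ lam z) (x y : E) :
    ‖x - y‖ₑ ^ 2 = ∑ l, ENNReal.ofReal ((z l x - z l y) ^ 2) := by
  rw [← ENNReal.ofReal_sum_of_nonneg fun _ _ => sq_nonneg _, ← h.norm_sub_sq, ← ofReal_norm,
    ENNReal.ofReal_pow (norm_nonneg _)]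

lemma measurable_enorm_sub_sq (h : IsGaussianCoordinates μ lam z) :
    Measurable fun p : E × E => ‖p.1 - p.2‖ₑ ^ 2 := by
  simp_rw [h.enorm_sub_sq]
  have := h.measurable
  fun_prop

lemma lintegral_prod (h : IsGaussianCoordinates μ lam z) {g : ι → ℝ → ℝ≥0∞}
    (hg : ∀ l, Measurable (g l)) :
    ∫⁻ x, ∏ l, g l (z l x) ∂μ = ∏ l, ∫⁻ w, g l w ∂(gaussianReal 0 (lam l).toNNReal) := by
  have h1 := lintegral_prod_eq_prod_lintegral_of_indepFun Finset.univ (fun l => g l ∘ z l)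
    (h.indep.comp g hg) fun l => (hg l).comp (h.measurable l)
  simp only [Function.comp_apply] at h1
  rw [h1]
  refine Finset.prod_congr rfl fun l _ => ?_
  rw [← h.map_eq l, lintegral_map (hg l) (h.measurable l)]

lemma lintegral_exp_totalLogRatio (h : IsGaussianCoordinates μ lam z) {ρ : ι → ℝ}
    (hρ : ∀ l, ρ l ^ 2 < 1) (x : E) :
    ∫⁻ y, ENNReal.ofReal (Real.exp (totalLogRatio lam ρ z x y)) ∂μ = 1 := by
  simp_rw [totalLogRatio, Real.exp_sum,
    ENNReal.ofReal_prod_of_nonneg fun _ _ => (Real.exp_pos _).le]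
  rw [h.lintegral_prod (g := fun l w =>
    ENNReal.ofReal (Real.exp (gaussianLogRatio (lam l) (ρ l) (z l x) w))) (by fun_prop)]
  refine Finset.prod_eq_one fun l _ => ?_
  rw [← setLIntegral_univ, ← withDensity_apply _ MeasurableSet.univ,
    gaussianReal_withDensity_exp_gaussianLogRatio (h.pos l) (hρ l), measure_univ]

lemma lintegral_sub_sq_mul_exp_totalLogRatio (h : IsGaussianCoordinates μ lam z) {ρ : ι → ℝ}
    (hρ : ∀ l, ρ l ^ 2 < 1) (x : E) (l : ι) :
    ∫⁻ y, ENNReal.ofReal (Real.exp (totalLogRatio lam ρ z x y))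
        * ENNReal.ofReal ((z l x - z l y) ^ 2) ∂μ
      = ENNReal.ofReal ((z l x - ρ l * z l x) ^ 2 + lam l * (1 - ρ l ^ 2)) := by
  classical
  have h0 : 0 < lam l * (1 - ρ l ^ 2) := mul_pos (h.pos l) (by linarith [hρ l])
  -- Putting the squared error in as a factor that is 1 off coordinate l keeps the integrand a
  -- product, so independence applies.
  have hprod : ∀ y, ENNReal.ofReal (Real.exp (totalLogRatio lam ρ z x y))
        * ENNReal.ofReal ((z l x - z l y) ^ 2)
      = ∏ k, (ENNReal.ofReal (Real.exp (gaussianLogRatio (lam k) (ρ k) (z k x) (z k y)))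
        * if k = l then ENNReal.ofReal ((z k x - z k y) ^ 2) else 1) := by
    intro y
    rw [totalLogRatio, Real.exp_sum, ENNReal.ofReal_prod_of_nonneg fun _ _ => (Real.exp_pos _).le,
      Finset.prod_mul_distrib]
    simp
  simp_rw [hprod]
  rw [h.lintegral_prod (g := fun k w =>
    ENNReal.ofReal (Real.exp (gaussianLogRatio (lam k) (ρ k) (z k x) w))
      * if k = l then ENNReal.ofReal ((z k x - w) ^ 2) else 1) fun k => by
        split_ifs <;> fun_prop]
  have hfac : ∀ k (g : ℝ → ℝ≥0∞), Measurable g →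
      ∫⁻ w, ENNReal.ofReal (Real.exp (gaussianLogRatio (lam k) (ρ k) (z k x) w)) * g w
          ∂(gaussianReal 0 (lam k).toNNReal)
        = ∫⁻ w, g w ∂(gaussianReal (ρ k * z k x) (lam k * (1 - ρ k ^ 2)).toNNReal) := by
    intro k g hg
    rw [← gaussianReal_withDensity_exp_gaussianLogRatio (h.pos k) (hρ k),
      lintegral_withDensity_eq_lintegral_mul _ (by fun_prop) hg]
    rfl
  rw [Finset.prod_eq_single l]
  · simp only [if_true]
    rw [hfac l _ (by fun_prop), lintegral_sub_sq_gaussianReal, Real.coe_toNNReal _ h0.le]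
  · intro k _ hk
    simp only [hk, if_false]
    rw [hfac k _ measurable_const]
    simp
  · simp

lemma integrable_sq (h : IsGaussianCoordinates μ lam z) (l : ι) :
    Integrable (fun x => z l x ^ 2) μ := by
  have h1 := integrable_sq_gaussianReal 0 (lam l).toNNReal
  rw [← h.map_eq l] at h1
  exact h1.comp_measurable (h.measurable l)

lemma integral_sq (h : IsGaussianCoordinates μ lam z) (l : ι) :
    (∫ x, z l x ^ 2 ∂μ) = lam l := by
  have h1 := integral_sq_gaussianReal 0 (lam l).toNNReal
  rw [← h.map_eq l, integral_map (h.measurable l).aemeasurable (by fun_prop)] at h1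
  simpa [(h.pos l).le] using h1

/-- The cross term in coordinate l has coefficient ρ_l/(λ_l(1 - ρ_l²)), which is t for every l;
polarization then gathers all cross terms into ‖x - y‖². -/
lemma totalLogRatio_eq (h : IsGaussianCoordinates μ lam z) {t : ℝ} {ρ : ι → ℝ}
    (hρ1 : ∀ l, ρ l ^ 2 < 1) (hρ : ∀ l, ρ l = t * lam l * (1 - ρ l ^ 2)) (x y : E) :
    totalLogRatio lam ρ z x y = ∑ l, (-(1 / 2) * Real.log (1 - ρ l ^ 2)
      + t / 2 * (1 - ρ l) * (z l x ^ 2 + z l y ^ 2)) - t / 2 * ‖x - y‖ ^ 2 := by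
  rw [totalLogRatio, h.norm_sub_sq, Finset.mul_sum, ← Finset.sum_sub_distrib]
  refine Finset.sum_congr rfl fun l _ => ?_
  have h1 : 0 < 1 - ρ l ^ 2 := by linarith [hρ1 l]
  have h2 := h.pos l
  have ht : t = ρ l / (lam l * (1 - ρ l ^ 2)) := by
    rw [eq_div_iff (by positivity)]; linarith [hρ l]
  rw [gaussianLogRatio, ht]
  field_simp
  ring

/-- The mean log-likelihood ratio under a coupling of `μ` with itself depends only on the
distortion of the coupling. -/
lemma integral_totalLogRatio (h : IsGaussianCoordinates μ lam z) {t : ℝ} {ρ : ι → ℝ}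
    (hρ1 : ∀ l, ρ l ^ 2 < 1) (hρ : ∀ l, ρ l = t * lam l * (1 - ρ l ^ 2))
    {P : Measure (E × E)} (h1 : P.fst = μ) (h2 : P.snd = μ) {d : ℝ} (hd : 0 ≤ d)
    (hP : ∫⁻ p, ‖p.1 - p.2‖ₑ ^ 2 ∂P = ENNReal.ofReal d) :
    Integrable (fun p => totalLogRatio lam ρ z p.1 p.2) P ∧
      (∫ p, totalLogRatio lam ρ z p.1 p.2 ∂P)
        = ∑ l, -(1 / 2) * Real.log (1 - ρ l ^ 2) + t * (∑ l, lam l * (1 - ρ l) - d / 2) := by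
  have := h.isProbabilityMeasure
  have : IsProbabilityMeasure P := ⟨by rw [← Measure.fst_univ, h1, measure_univ]⟩
  have hsq : ∀ p : E × E, ENNReal.ofReal (‖p.1 - p.2‖ ^ 2) = ‖p.1 - p.2‖ₑ ^ 2 := fun p => by
    rw [← ofReal_norm, ENNReal.ofReal_pow (norm_nonneg _)]
  have hm : Measurable fun p : E × E => ‖p.1 - p.2‖ ^ 2 := by
    simp_rw [h.norm_sub_sq]
    have := h.measurable
    fun_prop
  have hi : Integrable (fun p : E × E => ‖p.1 - p.2‖ ^ 2) P := by
    refine ⟨hm.aestronglyMeasurable, ?_⟩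
    rw [hasFiniteIntegral_iff_ofReal (ae_of_all _ fun _ => sq_nonneg _)]
    simp_rw [hsq, hP]
    exact ENNReal.ofReal_lt_top
  have hv : (∫ p : E × E, ‖p.1 - p.2‖ ^ 2 ∂P) = d := by
    rw [integral_eq_lintegral_of_nonneg_ae (ae_of_all _ fun _ => sq_nonneg _)
      hm.aestronglyMeasurable]
    simp_rw [hsq, hP]
    exact ENNReal.toReal_ofReal hd
  have hi1 : ∀ l, Integrable (fun p : E × E => z l p.1 ^ 2) P := fun l =>
    Integrable.comp_measurable (f := Prod.fst) (g := fun x => z l x ^ 2)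
      (by rw [← Measure.fst, h1]; exact h.integrable_sq l) measurable_fst
  have hi2 : ∀ l, Integrable (fun p : E × E => z l p.2 ^ 2) P := fun l =>
    Integrable.comp_measurable (f := Prod.snd) (g := fun x => z l x ^ 2)
      (by rw [← Measure.snd, h2]; exact h.integrable_sq l) measurable_snd
  have hv1 : ∀ l, (∫ p : E × E, z l p.1 ^ 2 ∂P) = lam l := fun l => by
    rw [← h.integral_sq l, ← h1, Measure.fst,
      integral_map (by fun_prop) ((h.measurable l).pow_const 2).aestronglyMeasurable]
  have hv2 : ∀ l, (∫ p : E × E, z l p.2 ^ 2 ∂P) = lam l := fun l => by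
    rw [← h.integral_sq l, ← h2, Measure.snd,
      integral_map (by fun_prop) ((h.measurable l).pow_const 2).aestronglyMeasurable]
  have hi12 : ∀ l, Integrable
      (fun p : E × E => t / 2 * (1 - ρ l) * (z l p.1 ^ 2 + z l p.2 ^ 2)) P := fun l =>
    ((hi1 l).add (hi2 l)).const_mul _
  have hi3 : ∀ l, Integrable (fun p : E × E => -(1 / 2) * Real.log (1 - ρ l ^ 2)
      + t / 2 * (1 - ρ l) * (z l p.1 ^ 2 + z l p.2 ^ 2)) P := fun l =>
    (integrable_const _).add (hi12 l)
  simp_rw [h.totalLogRatio_eq hρ1 hρ]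
  refine ⟨(integrable_finsetSum _ fun l _ => hi3 l).sub (hi.const_mul _), ?_⟩
  rw [integral_sub (integrable_finsetSum _ fun l _ => hi3 l) (hi.const_mul _),
    integral_finsetSum _ fun l _ => hi3 l, integral_const_mul, hv]
  have hv3 : ∀ l, (∫ p : E × E, -(1 / 2) * Real.log (1 - ρ l ^ 2)
      + t / 2 * (1 - ρ l) * (z l p.1 ^ 2 + z l p.2 ^ 2) ∂P)
      = -(1 / 2) * Real.log (1 - ρ l ^ 2) + t * (lam l * (1 - ρ l)) := fun l => by
    rw [integral_add (integrable_const _) (hi12 l), integral_const,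
      integral_const_mul, integral_add (hi1 l) (hi2 l), hv1, hv2]
    simp
    ring
  simp_rw [hv3]
  rw [Finset.sum_add_distrib, ← Finset.mul_sum _ _ t]
  ring

lemma integral_exp_totalLogRatio (h : IsGaussianCoordinates μ lam z) {ρ : ι → ℝ}
    (hρ : ∀ l, ρ l ^ 2 < 1) :
    Integrable (fun p : E × E => Real.exp (totalLogRatio lam ρ z p.1 p.2)) (μ.prod μ) ∧
      (∫ p : E × E, Real.exp (totalLogRatio lam ρ z p.1 p.2) ∂(μ.prod μ)) = 1 := by
  have := h.isProbabilityMeasure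
  have hm := (h.measurable_totalLogRatio ρ).exp
  have h1 : ∫⁻ p : E × E, ENNReal.ofReal (Real.exp (totalLogRatio lam ρ z p.1 p.2)) ∂(μ.prod μ)
      = 1 := by
    rw [MeasureTheory.lintegral_prod _ hm.ennreal_ofReal.aemeasurable]
    simp_rw [h.lintegral_exp_totalLogRatio hρ]
    simp
  constructor
  · refine ⟨hm.aestronglyMeasurable, ?_⟩
    rw [hasFiniteIntegral_iff_ofReal (ae_of_all _ fun _ => (Real.exp_pos _).le), h1]
    exact ENNReal.one_lt_top
  · rw [integral_eq_lintegral_of_nonneg_ae (ae_of_all _ fun _ => (Real.exp_pos _).le)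
      hm.aestronglyMeasurable, h1, ENNReal.toReal_one]

/-- The lower bound on the rate of a channel that preserves the source law. -/
lemma ofReal_le_mutualInfo (h : IsGaussianCoordinates μ lam z) {t : ℝ} (ht : 0 ≤ t) {ρ : ι → ℝ}
    (hρ1 : ∀ l, ρ l ^ 2 < 1) (hρ : ∀ l, ρ l = t * lam l * (1 - ρ l ^ 2))
    (κ : Kernel E E) [IsMarkovKernel κ] (hκ : μ.bind κ = μ)
    (hdist : distortion μ κ ≤ ENNReal.ofReal (2 * ∑ l, lam l * (1 - ρ l))) :
    ENNReal.ofReal (∑ l, -(1 / 2) * Real.log (1 - ρ l ^ 2)) ≤ mutualInfo μ κ := by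
  have := h.isProbabilityMeasure
  have hfin : distortion μ κ ≠ ∞ := ne_top_of_le_ne_top ENNReal.ofReal_ne_top hdist
  have hnn : 0 ≤ 2 * ∑ l, lam l * (1 - ρ l) := mul_nonneg zero_le_two <|
    Finset.sum_nonneg fun l _ => mul_nonneg (h.pos l).le (by nlinarith [hρ1 l])
  obtain ⟨h1, h2⟩ := h.integral_totalLogRatio hρ1 hρ (P := μ.compProd κ)
    (Measure.fst_compProd _ _) (by rw [Measure.snd_compProd, hκ])
    (d := (distortion μ κ).toReal) ENNReal.toReal_nonneg (ENNReal.ofReal_toReal hfin).symm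
  obtain ⟨h3, h4⟩ := h.integral_exp_totalLogRatio hρ1
  rw [mutualInfo, hκ]
  refine le_trans (ENNReal.ofReal_le_ofReal ?_) (ofReal_integral_le_klDiv _ _ h1 h3 h4)
  rw [h2]
  have h5 := ENNReal.toReal_le_of_le_ofReal hnn hdist
  have := mul_nonneg ht (show 0 ≤ ∑ l, lam l * (1 - ρ l) - (distortion μ κ).toReal / 2 by linarith)
  linarith

/-- The Gaussian channel with component correlations `ρ` attains the lower bound. -/
lemma exists_kernel (h : IsGaussianCoordinates μ lam z) {t : ℝ} {ρ : ι → ℝ}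
    (hρ1 : ∀ l, ρ l ^ 2 < 1) (hρ : ∀ l, ρ l = t * lam l * (1 - ρ l ^ 2)) :
    ∃ κ : Kernel E E, IsMarkovKernel κ ∧ μ.bind κ = μ ∧
      distortion μ κ = ENNReal.ofReal (2 * ∑ l, lam l * (1 - ρ l)) ∧
      mutualInfo μ κ = ENNReal.ofReal (∑ l, -(1 / 2) * Real.log (1 - ρ l ^ 2)) := by
  have := h.isProbabilityMeasure
  have hm : Measurable (Function.uncurry fun x y : E =>
      ENNReal.ofReal (Real.exp (totalLogRatio lam ρ z x y))) :=
    (h.measurable_totalLogRatio ρ).exp.ennreal_ofReal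
  have hterm : ∀ l, 0 ≤ lam l * (1 - ρ l) := fun l =>
    mul_nonneg (h.pos l).le (by nlinarith [hρ1 l])
  set κ : Kernel E E := Kernel.withDensity (Kernel.const E μ) fun x y =>
    ENNReal.ofReal (Real.exp (totalLogRatio lam ρ z x y)) with hκ
  have hmk : IsMarkovKernel κ := ⟨fun x => ⟨by
    rw [hκ, Kernel.withDensity_apply' _ hm, setLIntegral_univ, Kernel.const_apply,
      h.lintegral_exp_totalLogRatio hρ1]⟩⟩
  have hjoint : μ.compProd κ = (μ.prod μ).withDensity fun p =>
      ENNReal.ofReal (Real.exp (totalLogRatio lam ρ z p.1 p.2)) := by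
    rw [hκ, Measure.compProd_withDensity hm, Measure.compProd_const]
  -- The joint density is symmetric in x and y, so it also integrates to 1 over x.
  have hbind : μ.bind κ = μ := by
    ext s hs
    rw [Measure.bind_apply hs κ.aemeasurable]
    simp_rw [hκ, Kernel.withDensity_apply' _ hm, Kernel.const_apply]
    rw [lintegral_lintegral_swap hm.aemeasurable]
    simp_rw [fun x y => totalLogRatio_comm lam ρ z x y, h.lintegral_exp_totalLogRatio hρ1]
    simp
  have hdist : distortion μ κ = ENNReal.ofReal (2 * ∑ l, lam l * (1 - ρ l)) := by
    have hz := h.measurable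
    rw [distortion, Measure.lintegral_compProd h.measurable_enorm_sub_sq]
    simp_rw [h.enorm_sub_sq]
    have h1 : ∀ x, ∫⁻ y, ∑ l, ENNReal.ofReal ((z l x - z l y) ^ 2) ∂(κ x)
        = ∑ l, ENNReal.ofReal ((z l x - ρ l * z l x) ^ 2 + lam l * (1 - ρ l ^ 2)) := by
      intro x
      rw [lintegral_finsetSum _ (by fun_prop)]
      refine Finset.sum_congr rfl fun l _ => ?_
      rw [hκ, Kernel.lintegral_withDensity _ hm _ (by fun_prop), Kernel.const_apply,
        h.lintegral_sub_sq_mul_exp_totalLogRatio hρ1]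
    simp_rw [h1]
    rw [lintegral_finsetSum _ (by fun_prop), Finset.mul_sum,
      ENNReal.ofReal_sum_of_nonneg fun l _ => mul_nonneg zero_le_two (hterm l)]
    refine Finset.sum_congr rfl fun l _ => ?_
    have h2 : ∀ x, (z l x - ρ l * z l x) ^ 2 + lam l * (1 - ρ l ^ 2)
        = (1 - ρ l) ^ 2 * z l x ^ 2 + lam l * (1 - ρ l ^ 2) := fun x => by ring
    have h3 : 0 ≤ lam l * (1 - ρ l ^ 2) := mul_nonneg (h.pos l).le (by linarith [hρ1 l])
    have h4 : Integrable (fun x => (1 - ρ l) ^ 2 * z l x ^ 2 + lam l * (1 - ρ l ^ 2)) μ :=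
      ((h.integrable_sq l).const_mul _).add (integrable_const _)
    simp_rw [h2]
    rw [← ofReal_integral_eq_lintegral_ofReal h4
      (ae_of_all _ fun x => add_nonneg (by positivity) h3),
      integral_add ((h.integrable_sq l).const_mul _) (integrable_const _), integral_const_mul,
      h.integral_sq l, integral_const, probReal_univ, one_smul]
    congr 1
    ring
  refine ⟨κ, hmk, hbind, hdist, ?_⟩
  obtain ⟨h1, h2⟩ := h.integral_totalLogRatio hρ1 hρ (P := μ.compProd κ)
    (Measure.fst_compProd _ _) (by rw [Measure.snd_compProd, hbind])
    (mul_nonneg zero_le_two (Finset.sum_nonneg fun l _ => hterm l)) hdist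
  obtain ⟨h3, h4⟩ := h.integral_exp_totalLogRatio hρ1
  rw [mutualInfo, hbind]
  rw [hjoint] at h1 h2 ⊢
  -- The distortion is exactly 2 ∑ λ_l (1 - ρ_l), so the t term of the mean vanishes.
  rw [klDiv_withDensity_exp _ h3 h4 h1, h2]
  congr 1
  ring

end IsGaussianCoordinates

/-! ### Principal components of the Gaussian vector -/

/-- The quadratic form of S at Θᵀ e_l equals λ_l. -/
lemma pos_of_posDef_conj_diagonal {L : ℕ} {S Θ : Matrix (Fin L) (Fin L) ℝ} (hS : S.PosDef)
    (hΘ : Θ ∈ Matrix.orthogonalGroup (Fin L) ℝ) {lam : Fin L → ℝ}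
    (hdecomp : S = Θ.transpose * Matrix.diagonal lam * Θ) (l : Fin L) : 0 < lam l := by
  have h1 : Θ * Θ.transpose = 1 := (Matrix.mem_orthogonalGroup_iff _ _).1 hΘ
  have hne : Θ.transpose.mulVec (Pi.single l 1) ≠ 0 := fun h0 => by
    have h2 : Θ.mulVec (Θ.transpose.mulVec (Pi.single l 1)) = 0 := by rw [h0, Matrix.mulVec_zero]
    rw [Matrix.mulVec_mulVec, h1, Matrix.one_mulVec] at h2
    simpa using congrFun h2 l
  have h3 := hS.dotProduct_mulVec_pos hne
  have h4 : S.mulVec (Θ.transpose.mulVec (Pi.single l 1))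
      = Θ.transpose.mulVec ((Matrix.diagonal lam).mulVec (Pi.single l 1)) := by
    rw [hdecomp, Matrix.mulVec_mulVec, Matrix.mulVec_mulVec, Matrix.mul_assoc, Matrix.mul_assoc,
      h1, Matrix.mul_one]
  rw [h4, star_trivial, Matrix.dotProduct_mulVec, Matrix.vecMul_transpose, Matrix.mulVec_mulVec,
    h1, Matrix.one_mulVec] at h3
  simpa using h3

lemma charFun_map_mulVec {L : ℕ} (μ : Measure (EuclideanSpace ℝ (Fin L)))
    (Θ : Matrix (Fin L) (Fin L) ℝ) (t : EuclideanSpace ℝ (Fin L)) :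
    charFun ((μ.map (fun (x : EuclideanSpace ℝ (Fin L)) l => Θ.mulVec x.ofLp l)).map
      (WithLp.toLp 2)) t = charFun μ (WithLp.toLp 2 (Θ.transpose.mulVec t.ofLp)) := by
  have hm : Measurable (fun (x : EuclideanSpace ℝ (Fin L)) l => Θ.mulVec x.ofLp l) := by
    simp only [Matrix.mulVec, dotProduct]
    fun_prop
  have hm2 : Measurable (WithLp.toLp 2 : (Fin L → ℝ) → EuclideanSpace ℝ (Fin L)) :=
    WithLp.measurable_toLp 2 _
  rw [Measure.map_map hm2 hm, charFun_apply, charFun_apply,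
    integral_map (hm2.comp hm).aemeasurable (by fun_prop)]
  refine integral_congr_ae (ae_of_all _ fun x => ?_)
  have h : inner ℝ (WithLp.toLp 2 fun l => Θ.mulVec x.ofLp l) t
      = inner ℝ x (WithLp.toLp 2 (Θ.transpose.mulVec t.ofLp)) := by
    rw [EuclideanSpace.inner_eq_star_dotProduct, EuclideanSpace.inner_eq_star_dotProduct]
    simp only [star_trivial]
    rw [Matrix.mulVec_transpose, ← Matrix.dotProduct_mulVec]
  simp only [Function.comp_apply, h]

/-- The principal components of a centered Gaussian vector are independent. -/
lemma isGaussianCoordinates_multivariateGaussian {L : ℕ} {S Θ : Matrix (Fin L) (Fin L) ℝ}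
    (hS : S.PosDef) (hΘ : Θ ∈ Matrix.orthogonalGroup (Fin L) ℝ) {lam : Fin L → ℝ}
    (hdecomp : S = Θ.transpose * Matrix.diagonal lam * Θ) :
    IsGaussianCoordinates (multivariateGaussian 0 S) lam
      (fun l (x : EuclideanSpace ℝ (Fin L)) => Θ.mulVec x.ofLp l) := by
  have hpos := pos_of_posDef_conj_diagonal hS hΘ hdecomp
  have h1 : Θ * Θ.transpose = 1 := (Matrix.mem_orthogonalGroup_iff _ _).1 hΘ
  have h1' : Θ.transpose * Θ = 1 := (Matrix.mem_orthogonalGroup_iff' _ _).1 hΘ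
  have hm : ∀ l, Measurable (fun x : EuclideanSpace ℝ (Fin L) => Θ.mulVec x.ofLp l) := by
    intro l
    simp only [Matrix.mulVec, dotProduct]
    fun_prop
  have hm' : Measurable (fun (x : EuclideanSpace ℝ (Fin L)) l => Θ.mulVec x.ofLp l) :=
    measurable_pi_lambda _ hm
  have : IsProbabilityMeasure ((multivariateGaussian 0 S).map
      (fun (x : EuclideanSpace ℝ (Fin L)) l => Θ.mulVec x.ofLp l)) :=
    Measure.isProbabilityMeasure_map hm'.aemeasurable
  have hmap : (multivariateGaussian 0 S).map
      (fun (x : EuclideanSpace ℝ (Fin L)) l => Θ.mulVec x.ofLp l)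
      = Measure.pi fun l => gaussianReal 0 (lam l).toNNReal := by
    -- Independence is read off the characteristic function, which factorizes because Θ S Θᵀ is
    -- diagonal.
    refine charFun_eq_pi_iff.1 fun t => ?_
    have h2 := charFun_map_mulVec (multivariateGaussian 0 S) Θ t
    have h3 : S.mulVec (Θ.transpose.mulVec t.ofLp)
        = Θ.transpose.mulVec ((Matrix.diagonal lam).mulVec t.ofLp) := by
      rw [hdecomp, Matrix.mulVec_mulVec, Matrix.mulVec_mulVec, Matrix.mul_assoc, Matrix.mul_assoc,
        h1, Matrix.mul_one]
    rw [h2, charFun_multivariateGaussian hS.posSemidef]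
    simp only [h3, charFun_gaussianReal]
    rw [Matrix.dotProduct_mulVec, Matrix.vecMul_transpose, Matrix.mulVec_mulVec,
      h1, Matrix.one_mulVec, ← Complex.exp_sum]
    congr 1
    simp only [inner_zero_right, dotProduct, Matrix.mulVec_diagonal, Complex.ofReal_zero, mul_zero,
      zero_mul, zero_sub, Finset.sum_neg_distrib, Real.coe_toNNReal _ (hpos _).le]
    rw [Complex.ofReal_sum, Finset.sum_div]
    congr 1
    refine Finset.sum_congr rfl fun l _ => ?_
    push_cast
    ring
  have hmapl : ∀ l, (multivariateGaussian 0 S).map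
      (fun x : EuclideanSpace ℝ (Fin L) => Θ.mulVec x.ofLp l)
      = gaussianReal 0 (lam l).toNNReal := by
    intro l
    have h2 := (measurePreserving_eval (fun l => gaussianReal 0 (lam l).toNNReal) l).map_eq
    rw [← hmap, Measure.map_map (by fun_prop) hm'] at h2
    exact h2
  refine ⟨hpos, hm, ?_, hmapl, fun x y => ?_⟩
  · rw [iIndepFun_iff_map_fun_eq_pi_map fun l => (hm l).aemeasurable, hmap]
    simp_rw [hmapl]
  · have h2 : ∑ l, (Θ.mulVec x.ofLp l - Θ.mulVec y.ofLp l) ^ 2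
        = Θ.mulVec (x - y).ofLp ⬝ᵥ Θ.mulVec (x - y).ofLp := by
      rw [WithLp.ofLp_sub, Matrix.mulVec_sub]
      exact Finset.sum_congr rfl fun l _ => by rw [Pi.sub_apply]; ring
    rw [h2, Matrix.dotProduct_mulVec, ← Matrix.mulVec_transpose, Matrix.mulVec_mulVec, h1',
      Matrix.one_mulVec, EuclideanSpace.real_norm_sq_eq]
    exact Finset.sum_congr rfl fun l _ => by ring

/-! ### The rate at perfect perception and the conclusion -/

/-- The rate-distortion-perception function at perfect perception, in terms of the optimal
component correlations. -/
lemma rate_zero_eq {E ι : Type*} [Fintype ι] [NormedAddCommGroup E] [InnerProductSpace ℝ E]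
    [CompleteSpace E] [SecondCountableTopology E] [MeasurableSpace E] [BorelSpace E]
    {μ : Measure E} {lam : ι → ℝ} {z : ι → E → ℝ} (h : IsGaussianCoordinates μ lam z)
    (φ : PerceptionMetric) {t : ℝ} (ht : 0 ≤ t) {ρ : ι → ℝ}
    (hρ1 : ∀ l, ρ l ^ 2 < 1) (hρ : ∀ l, ρ l = t * lam l * (1 - ρ l ^ 2)) :
    rate φ μ (ENNReal.ofReal (2 * ∑ l, lam l * (1 - ρ l))) 0
      = ENNReal.ofReal (∑ l, -(1 / 2) * Real.log (1 - ρ l ^ 2)) := by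
  have := h.isProbabilityMeasure
  apply le_antisymm
  · obtain ⟨κ, hκ, h1, h2, h3⟩ := h.exists_kernel hρ1 hρ
    rw [← h3]
    exact iInf₂_le_of_le κ hκ (iInf₂_le_of_le h2.le
      ((φ.loss_le_zero_iff _ _).2 h1) le_rfl)
  · refine le_iInf₂ fun κ hκ => le_iInf₂ fun h1 h2 => ?_
    exact h.ofReal_le_mutualInfo ht hρ1 hρ κ ((φ.loss_le_zero_iff _ _).1 h2) h1

end RDP

theorem proposition3 {L : ℕ} (hL : 0 < L)
    (S : Matrix (Fin L) (Fin L) ℝ) (hS : S.PosDef)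
    (Θ : Matrix (Fin L) (Fin L) ℝ) (hΘ : Θ ∈ Matrix.orthogonalGroup (Fin L) ℝ)
    (lam : Fin L → ℝ) (hdecomp : S = Θ.transpose * Matrix.diagonal lam * Θ)
    (φ : RDP.PerceptionMetric) :
    ∃ C : ℝ, ∃ ε₀ : ℝ, 0 < ε₀ ∧ ∀ ε : ℝ, 0 < ε → ε < ε₀ →
      0 < 2 * (∑ l, lam l) - ε ∧
      RDP.rate φ (multivariateGaussian 0 S) (ENNReal.ofReal (2 * (∑ l, lam l) - ε)) 0 ≠ ∞ ∧
      |(RDP.rate φ (multivariateGaussian 0 S) (ENNReal.ofReal (2 * (∑ l, lam l) - ε)) 0).toReal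
          - ε ^ 2 / (8 * (∑ l, lam l ^ 2))| ≤ C * ε ^ 3 ∧
      (∃! p, RDP.IsOptimalAllocation φ lam (ENNReal.ofReal (2 * (∑ l, lam l) - ε)) 0 p) ∧
      ∀ p, RDP.IsOptimalAllocation φ lam (ENNReal.ofReal (2 * (∑ l, lam l) - ε)) 0 p →
        RDP.rate φ (multivariateGaussian 0 S) (ENNReal.ofReal (2 * (∑ l, lam l) - ε)) 0
            = ENNReal.ofReal (RDP.allocationRate lam p.1) ∧
        ∀ l, |p.1 l - (lam l - ε ^ 2 * lam l ^ 3 / (4 * (∑ k, lam k ^ 2) ^ 2))| ≤ C * ε ^ 3 := by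
  have hz := RDP.isGaussianCoordinates_multivariateGaussian hS hΘ hdecomp
  obtain ⟨C, ε₀, hε₀, hε₀M, H⟩ := RDP.exists_correlations hL lam hz.pos
  refine ⟨C, ε₀, hε₀, fun ε hε hεε₀ => ?_⟩
  obtain ⟨t, ρ, ht, hρ0, hρ1, hρ, hsum, hrate, hlevel⟩ := H ε hε hεε₀
  have hεM : ε ≤ ∑ l, lam l := hεε₀.le.trans hε₀M
  have hρsq : ∀ l, ρ l ^ 2 < 1 := fun l => by nlinarith [hρ0 l, hρ1 l]
  have hD : 2 * (∑ l, lam l) - ε = 2 * ∑ l, lam l * (1 - ρ l) := by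
    simp_rw [mul_sub, mul_one]
    rw [Finset.sum_sub_distrib, hsum]
    ring
  have hR := RDP.rate_zero_eq hz φ ht hρsq hρ
  rw [← hD] at hR
  have hopt := RDP.isOptimalAllocation_iff φ hz.pos hεM ht hρ0 hρ1 hρ hsum
  have hnn : 0 ≤ ∑ l, -(1 / 2) * Real.log (1 - ρ l ^ 2) := Finset.sum_nonneg fun l _ =>
    mul_nonneg_of_nonpos_of_nonpos (by norm_num)
      (Real.log_nonpos (by linarith [hρsq l]) (by linarith [sq_nonneg (ρ l)]))
  refine ⟨by linarith, by rw [hR]; exact ENNReal.ofReal_ne_top, ?_,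
    ⟨_, (hopt _).2 rfl, fun p hp => (hopt p).1 hp⟩, fun p hp => ?_⟩
  · rw [hR, ENNReal.toReal_ofReal hnn]
    exact hrate
  · rw [(hopt p).1 hp]
    refine ⟨?_, hlevel⟩
    rw [hR, RDP.allocationRate, Finset.mul_sum]
    congr 1
    refine Finset.sum_congr rfl fun l _ => ?_
    rw [← inv_div _ (lam l), Real.log_inv, mul_div_cancel_left₀ _ (hz.pos l).ne']
    ring
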